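/- Let $\mathbb T\subset\mathbb R$ be a closed set with $0\in\mathbb T$. For $t\in\mathbb T$ put $\sigma(t)=\inf\{s\in\mathbb T: s>t\}$ and $\mu(t)=\sigma(t)-t$, let $\mathbb S=\{t\in\mathbb T:\sigma(t)>t\}$ be the set of right-scattered points, and assume $\sup\mathbb S=+\infty$. Write $\mathbb T^+_a=\mathbb T\cap[a,\infty)$ and $B_r=\{x\in\mathbb R^n:|x|<r\}$, with $|\cdot|$ the Euclidean norm. The $\Delta$-derivative $x^\Delta(t)$ is the vector $v$ (if any) such that for every $\eta>0$ the inequality $|x(\sigma(t))-x(s)-(\sigma(t)-s)v|\le\eta|\sigma(t)-s|$ holds for all $s$ of the time scale in a neighbourhood of $t$; for solutions started at $t_0$ the time scale is $\mathbb T^+_{t_0}$. Let $A$ be a real $n\times n$ matrix that is strongly stable with respect to $\mathbb T$, i.e. every complex eigenvalue $\lambda$ of $A$ satisfies $$\limsup_{\mathbb S\ni t\to+\infty}\frac{|1+\mu(t)\lambda|^2-1}{\mu(t)}<0 .$$ Then there is $\varepsilon>0$ such that for every $r>0$ and every $f:\mathbb T^+_0\times B_r\to\mathbb R^n$ for which there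 is $r_1\in(0,r]$ with $$|f(t,x)|\le\varepsilon|x|\qquad\text{for all }t\in\mathbb T^+_0,\ x\in B_{r_1},$$ the zero solution of $$x^\Delta=Ax+f(t,x)$$ is asymptotically stable, that is: (i) for every $t_0\in\mathbb T^+_0$ and $\eta>0$ there is $\delta>0$ such that every solution $x$ with $|x(t_0)|<\delta$, on any segment $\mathbb T\cap[t_0,b]$ with $b\in\mathbb T^+_{t_0}$, satisfies $|x(t)|<\eta$ for all $t\in\mathbb T\cap[t_0,b]$ (a solution on $\mathbb T\cap[t_0,b]$ is continuous there, and for $t<b$ it lies in $B_r$ and satisfies the equation); (ii) for every $t_0\in\mathbb T^+_0$ there is $c>0$ such that every solution $x$ on $\mathbb T^+_{t_0}$ with values in $B_r$ and $|x(t_0)|<c$ satisfies $x(t)\to0$ as $\mathbb T\ni t\to+\infty$. If moreover $f$ is continuous on $\mathbb T^+_0\times B_r$, then for every $t_0\in\mathbb T^+_0$ there is $\delta>0$ such that for every $x_0$ with $|x_0|<\delta$ there is a solution on all of $\mathbb T^+_{t_0}$ with values in $B_r$ and $x(t_0)=x_0$. -/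

import Mathlib

open Set Filter Topology

noncomputable section

namespace TimeScale

/-- Forward jump operator `σ(t) = inf {s ∈ T : s > t}`. -/
def sigma (T : Set ℝ) (t : ℝ) : ℝ := sInf {s | s ∈ T ∧ t < s}

/-- Graininess `μ(t) = σ(t) - t`. -/
def mu (T : Set ℝ) (t : ℝ) : ℝ := sigma T t - t

/-- The set of right-scattered points of `T`. -/
def rightScattered (T : Set ℝ) : Set ℝ := {t | t ∈ T ∧ t < sigma T t}

/-- The part `T ∩ [a, ∞)` of `T`. -/
def ray (T : Set ℝ) (a : ℝ) : Set ℝ := T ∩ Ici a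

/-- A time scale: a closed subset of `ℝ` containing `0` whose right-scattered points
are unbounded above (in particular `T` itself is unbounded above, so that `sigma` is
always the infimum of a nonempty set). -/
structure IsTimeScale (T : Set ℝ) : Prop where
  isClosed : IsClosed T
  zero_mem : (0 : ℝ) ∈ T
  not_bddAbove : ¬ BddAbove (rightScattered T)

/-- `x : T → E` is `Δ`-differentiable at `t` with `Δ`-derivative `v`. Only the values of `x`
on `T` matter. -/
def HasDeltaDerivAt {E : Type*} [NormedAddCommGroup E] [NormedSpace ℝ E]
    (T : Set ℝ) (x : ℝ → E) (v : E) (t : ℝ) : Prop :=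
  ∀ ε > 0, ∀ᶠ s in 𝓝[T] t,
    ‖(x (sigma T t) - x s) - (sigma T t - s) • v‖ ≤ ε * |sigma T t - s|

/-- `A` is strongly stable with respect to `T`: every complex eigenvalue `z` of `A` satisfies
`limsup (|1 + μ(t) z|² - 1) / μ(t) < 0` as `t → +∞` along the right-scattered points. The limsup
is taken in the extended reals. -/
def StronglyStable (T : Set ℝ) {n : ℕ} (A : Matrix (Fin n) (Fin n) ℝ) : Prop :=
  ∀ z : ℂ, Module.End.HasEigenvalue (Matrix.toLin' (A.map Complex.ofReal)) z →
    limsup (fun t : ℝ => (((‖1 + (mu T t : ℂ) * z‖ ^ 2 - 1) / mu T t : ℝ) : EReal))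
      (atTop ⊓ 𝓟 (rightScattered T)) < 0

section Systems

variable {E : Type*} [NormedAddCommGroup E] [NormedSpace ℝ E]

/-- `x` solves `x^Δ = F(t, x)` on `T ∩ [t₀, b]`, where `F(t, ·)` is given on the ball `B_r`:
`x` is continuous on `T ∩ [t₀, b]`, and for `t < b` it lies in `B_r` and satisfies the equation,
the `Δ`-derivative being taken in `T ∩ [t₀, ∞)` (so one-sided at `t₀`). The end value `x b` is not
required to lie in `B_r`, so that solutions which leave `B_r` are included up to their exit. -/
def IsSolutionUpTo (T : Set ℝ) (r : ℝ) (F : ℝ → E → E) (t₀ b : ℝ) (x : ℝ → E) : Prop :=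
  ContinuousOn x (T ∩ Icc t₀ b) ∧
    ∀ t ∈ T, t₀ ≤ t → t < b →
      x t ∈ Metric.ball (0 : E) r ∧ HasDeltaDerivAt (ray T t₀) x (F t (x t)) t

/-- `x` solves `x^Δ = F(t, x)` on `T ∩ [t₀, ∞)` and stays in the ball `B_r`. -/
def IsGlobalSolution (T : Set ℝ) (r : ℝ) (F : ℝ → E → E) (t₀ : ℝ) (x : ℝ → E) : Prop :=
  ∀ t ∈ ray T t₀,
    x t ∈ Metric.ball (0 : E) r ∧ HasDeltaDerivAt (ray T t₀) x (F t (x t)) t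

/-- Stability of the zero solution of `x^Δ = F(t, x)`, `t ∈ T ∩ [0, ∞)`, `x ∈ B_r`: every solution
that starts `δ`-close to `0` at `t₀` stays `ε`-close to `0` as long as it is defined. -/
def ZeroStable (T : Set ℝ) (r : ℝ) (F : ℝ → E → E) : Prop :=
  ∀ t₀ ∈ ray T 0, ∀ ε > 0, ∃ δ > 0, ∀ b ∈ ray T t₀, ∀ x : ℝ → E,
    IsSolutionUpTo T r F t₀ b x → ‖x t₀‖ < δ → ∀ t ∈ T ∩ Icc t₀ b, ‖x t‖ < ε

/-- Asymptotic stability of the zero solution: stability, and for each `t₀` every solution that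
starts close enough to `0` at `t₀` tends to `0` as `T ∋ t → +∞`. -/
def ZeroAsymptoticallyStable (T : Set ℝ) (r : ℝ) (F : ℝ → E → E) : Prop :=
  ZeroStable T r F ∧
    ∀ t₀ ∈ ray T 0, ∃ c > 0, ∀ x : ℝ → E,
      IsGlobalSolution T r F t₀ x → ‖x t₀‖ < c → Tendsto x (atTop ⊓ 𝓟 T) (𝓝 0)

/-- For each `t₀`, all sufficiently small initial values at `t₀` admit a solution on the whole of
`T ∩ [t₀, ∞)`. -/
def SmallDataGlobalExistence (T : Set ℝ) (r : ℝ) (F : ℝ → E → E) : Prop :=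
  ∀ t₀ ∈ ray T 0, ∃ δ > 0, ∀ x₀ : E, ‖x₀‖ < δ →
    ∃ x : ℝ → E, x t₀ = x₀ ∧ IsGlobalSolution T r F t₀ x

end Systems

end TimeScale

end

/-! Since (|1 + μz|² - 1)/μ = 2 Re z + μ|z|², strong stability eventually bounds the graininess by
some M > 0 with |1 + Mz| < 1 for all eigenvalues z of A (`StronglyStable.exists_bound`). Hence a
power of B = 1 + MA is a contraction, and the sum N of the norms of finitely many iterates of B
strictly decreases under B. For 0 ≤ h ≤ M the step x + hAx is a convex combination of x and Bx, so
the single norm N decreases along all admissible steps, at right-scattered and right-dense points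
alike (`StronglyStable.exists_seminorm`).

A perturbation of size ε|x| with ε small costs only part of this decrease. Comparison with an
exponential (`seminorm_le_exp`) then yields decay from some t₁ on, and at most exponential growth
between t₀ and t₁. The step condition is needed only where the bound already holds, so smallness of
f near 0 suffices. The resulting estimate, `StronglyStable.exists_estimate`, gives both stability
claims.

For existence, Euler polygons converge along an ultrafilter to a solution of a truncated equation
(`exists_forall_hasDeltaDerivAt`); the same estimate shows that the truncation is never active. -/

namespace TimeScale

/-! ### Forward jumps, Δ-derivatives and exponential comparison -/

section Comparison

variable {T : Set ℝ} {E : Type*} [NormedAddCommGroup E] [NormedSpace ℝ E]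

lemma IsTimeScale.exists_gt (hT : IsTimeScale T) (t : ℝ) : ∃ s ∈ T, t < s := by
  obtain ⟨s, hs, hts⟩ := not_bddAbove_iff.1 hT.not_bddAbove t
  exact ⟨s, hs.1, hts⟩

lemma bddBelow_gt (T : Set ℝ) (t : ℝ) : BddBelow {s | s ∈ T ∧ t < s} :=
  ⟨t, fun _ hs => hs.2.le⟩

lemma sigma_le {t s : ℝ} (hs : s ∈ T) (hts : t < s) : sigma T t ≤ s :=
  csInf_le (bddBelow_gt T t) ⟨hs, hts⟩

lemma le_of_lt_sigma {t s : ℝ} (hs : s ∈ T) (h : s < sigma T t) : s ≤ t := by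
  by_contra! hts
  exact absurd (sigma_le hs hts) (not_le.2 h)

lemma le_sigma (hT : IsTimeScale T) (t : ℝ) : t ≤ sigma T t := by
  obtain ⟨s, hs, hts⟩ := hT.exists_gt t
  exact le_csInf ⟨s, hs, hts⟩ fun _ h => h.2.le

lemma mu_nonneg (hT : IsTimeScale T) (t : ℝ) : 0 ≤ mu T t :=
  sub_nonneg.2 (le_sigma hT t)

lemma sigma_mem (hT : IsTimeScale T) (t : ℝ) : sigma T t ∈ T := by
  obtain ⟨s, hs, hts⟩ := hT.exists_gt t
  have h := csInf_mem_closure (s := {s | s ∈ T ∧ t < s}) ⟨s, hs, hts⟩ (bddBelow_gt T t)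
  exact closure_minimal (fun _ h => h.1) hT.isClosed h

lemma sigma_ray {t₀ t : ℝ} (h : t₀ ≤ t) : sigma (ray T t₀) t = sigma T t := by
  unfold sigma ray
  congr 1
  ext s
  simp only [mem_ofPred_eq, mem_inter_iff, mem_Ici]
  exact ⟨fun hs => ⟨hs.1.1, hs.2⟩, fun hs => ⟨⟨hs.1, h.trans hs.2.le⟩, hs.2⟩⟩

/-- The value of a `Δ`-differentiable function at the forward jump. -/
lemma HasDeltaDerivAt.apply_sigma {S : Set ℝ} {x : ℝ → E} {v : E} {t : ℝ}
    (h : HasDeltaDerivAt S x v t) (ht : t ∈ S) :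
    x (sigma S t) = x t + (sigma S t - t) • v := by
  have h0 : ‖(x (sigma S t) - x t) - (sigma S t - t) • v‖ ≤ 0 := by
    have : ∀ ε > 0, ‖(x (sigma S t) - x t) - (sigma S t - t) • v‖ ≤ ε * |sigma S t - t| :=
      fun ε hε => (h ε hε).self_of_nhdsWithin ht
    have hl : Tendsto (fun ε : ℝ => ε * |sigma S t - t|) (𝓝[>] 0) (𝓝 0) := by
      have : Tendsto (fun ε : ℝ => ε * |sigma S t - t|) (𝓝 0) (𝓝 (0 * |sigma S t - t|)) :=
        (continuous_id.mul continuous_const).tendsto 0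
      rw [zero_mul] at this
      exact this.mono_left nhdsWithin_le_nhds
    exact ge_of_tendsto hl (eventually_mem_nhdsWithin.mono fun ε hε => this ε hε)
  have h1 := norm_le_zero_iff.1 h0
  rw [sub_sub, sub_eq_zero] at h1
  exact h1

/-- At a right-scattered point the error ε|σ(t) - s| does not vanish as s → t for fixed ε, but ε is
free and |σ(t) - s| stays bounded. -/
lemma HasDeltaDerivAt.continuousWithinAt {S : Set ℝ} {x : ℝ → E} {v : E} {t : ℝ}
    (h : HasDeltaDerivAt S x v t) (ht : t ∈ S) : ContinuousWithinAt x S t := by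
  have hs := h.apply_sigma ht
  set m := sigma S t with hm
  have key : ∀ ε > 0, ∀ᶠ s in 𝓝[S] t, ‖x s - x t‖ ≤ ε * |m - s| + |s - t| * ‖v‖ := by
    intro ε hε
    filter_upwards [h ε hε] with s hs'
    have e : x s - x t = -((x m - x s) - (m - s) • v) + (s - t) • v := by
      rw [hs]; module
    rw [e]
    refine (norm_add_le _ _).trans ?_
    rw [norm_neg, norm_smul, Real.norm_eq_abs]
    gcongr
  rw [ContinuousWithinAt, tendsto_iff_norm_sub_tendsto_zero]
  rw [Metric.tendsto_nhds]
  intro η hη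
  have hpos : 0 < |m - t| + 1 := by positivity
  have hc : Tendsto (fun s => η / (2 * (|m - t| + 1)) * |m - s| + |s - t| * ‖v‖) (𝓝[S] t)
      (𝓝 (η / (2 * (|m - t| + 1)) * |m - t| + |t - t| * ‖v‖)) := by
    apply Tendsto.mono_left _ nhdsWithin_le_nhds
    apply Continuous.tendsto
    fun_prop
  have hlt : η / (2 * (|m - t| + 1)) * |m - t| + |t - t| * ‖v‖ < η := by
    rw [sub_self, abs_zero, zero_mul, add_zero, div_mul_eq_mul_div, div_lt_iff₀ (by positivity)]
    nlinarith [abs_nonneg (m - t)]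
  filter_upwards [key _ (by positivity : 0 < η / (2 * (|m - t| + 1))), hc.eventually_lt_const hlt]
    with s h1 h2
  rw [Real.dist_0_eq_abs, abs_of_nonneg (norm_nonneg _)]
  exact h1.trans_lt h2

/-- Induction principle for inequalities on a time scale. -/
lemma le_of_forall_step (hT : IsTimeScale T) {u φ : ℝ → ℝ} {p b : ℝ} (hp : p ∈ T) (hb : b ∈ T)
    (hpb : p ≤ b) (hu : ContinuousOn u (T ∩ Icc p b)) (hφ : Continuous φ) (h0 : u p ≤ φ p)
    (hscat : ∀ t ∈ T, p ≤ t → t < b → t < sigma T t → u t ≤ φ t → u (sigma T t) ≤ φ (sigma T t))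
    (hdense : ∀ t ∈ T, p ≤ t → t < b → sigma T t = t → u t ≤ φ t →
      ∀ᶠ s in 𝓝 t, s ∈ T → t < s → u s ≤ φ s) :
    u b ≤ φ b := by
  by_contra! hbad
  set Z : Set ℝ := {t | t ∈ T ∩ Icc p b ∧ φ t < u t} with hZ
  have hbZ : b ∈ Z := ⟨⟨hb, hpb, le_rfl⟩, hbad⟩
  have hbd : BddBelow Z := ⟨p, fun t ht => ht.1.2.1⟩
  have hcl : IsClosed (T ∩ Icc p b) := hT.isClosed.inter isClosed_Icc
  set τ := sInf Z with hτ
  have hτm : τ ∈ T ∩ Icc p b :=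
    closure_minimal (fun _ h => h.1) hcl (csInf_mem_closure ⟨b, hbZ⟩ hbd)
  have hlt : ∀ t ∈ T, p ≤ t → t < τ → u t ≤ φ t := by
    intro t ht hpt htτ
    by_contra! hcon
    exact absurd (csInf_le hbd ⟨⟨ht, hpt, htτ.le.trans hτm.2.2⟩, hcon⟩) (not_le.2 htτ)
  -- If the bound fails at τ, then τ is either the jump of its predecessor ρ or a limit of good
  -- points from the left. If it holds at τ, bad points accumulate at τ from the right, so τ is
  -- right-dense.
  rcases lt_or_ge (φ τ) (u τ) with hcase | hcase
  · have hpτ : p < τ := by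
      refine lt_of_le_of_ne hτm.2.1 fun h => ?_
      rw [← h] at hcase
      exact absurd h0 (not_le.2 hcase)
    set ρ := sSup (T ∩ Ico p τ) with hρ
    have hne : (T ∩ Ico p τ).Nonempty := ⟨p, hp, le_rfl, hpτ⟩
    have hba : BddAbove (T ∩ Ico p τ) := ⟨τ, fun t ht => ht.2.2.le⟩
    have hρc : ρ ∈ closure (T ∩ Ico p τ) := csSup_mem_closure hne hba
    have hρT : ρ ∈ T := closure_minimal (fun _ h => h.1) hT.isClosed hρc
    have hpρ : p ≤ ρ := le_csSup hba ⟨hp, le_rfl, hpτ⟩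
    have hρτ : ρ ≤ τ := csSup_le hne fun t ht => ht.2.2.le
    rcases hρτ.lt_or_eq with hlt' | heq
    · have hσ : sigma T ρ = τ := by
        refine le_antisymm (sigma_le hτm.1 hlt') (le_csInf ⟨τ, hτm.1, hlt'⟩ fun s hs => ?_)
        by_contra! hsτ
        exact absurd (le_csSup hba ⟨hs.1, hpρ.trans hs.2.le, hsτ⟩) (not_le.2 hs.2)
      have := hscat ρ hρT hpρ (hlt'.trans_le hτm.2.2) (by rw [hσ]; exact hlt')
        (hlt ρ hρT hpρ hlt')
      rw [hσ] at this
      exact absurd this (not_le.2 hcase)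
    · rw [heq] at hρc
      have hsub : T ∩ Ico p τ ⊆ T ∩ Icc p b :=
        fun t ht => ⟨ht.1, ht.2.1, ht.2.2.le.trans hτm.2.2⟩
      have hnb : (𝓝[T ∩ Ico p τ] τ).NeBot := mem_closure_iff_nhdsWithin_neBot.1 hρc
      have h1 : Tendsto u (𝓝[T ∩ Ico p τ] τ) (𝓝 (u τ)) := (hu τ hτm).mono hsub
      have h2 : Tendsto φ (𝓝[T ∩ Ico p τ] τ) (𝓝 (φ τ)) := hφ.continuousWithinAt
      refine absurd (le_of_tendsto_of_tendsto h1 h2 ?_) (not_le.2 hcase)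
      exact eventually_mem_nhdsWithin.mono fun t ht => hlt t ht.1 ht.2.1 ht.2.2
  · have hgt : ∀ t ∈ Z, τ < t := fun t ht => by
      refine lt_of_le_of_ne (csInf_le hbd ht) fun h => ?_
      rw [← h] at ht
      exact absurd ht.2 (not_lt.2 hcase)
    have hτb : τ < b := hgt b hbZ
    rcases (le_sigma hT τ).lt_or_eq with hs | hs
    · have h1 := hscat τ hτm.1 hτm.2.1 hτb hs hcase
      have : sigma T τ ≤ τ := le_csInf ⟨b, hbZ⟩ fun t ht => sigma_le ht.1.1 (hgt t ht)
      exact absurd this (not_le.2 hs)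
    · have h1 := hdense τ hτm.1 hτm.2.1 hτb hs.symm hcase
      obtain ⟨δ, hδ, h2⟩ := Metric.eventually_nhds_iff.1 h1
      obtain ⟨t, ht, htδ⟩ := exists_lt_of_csInf_lt ⟨b, hbZ⟩ (show sInf Z < τ + δ by linarith)
      have htτ := hgt t ht
      refine absurd (h2 ?_ ht.1.1 htτ) (not_le.2 ht.2)
      rw [Real.dist_eq, abs_of_pos (by linarith)]
      linarith

/-- Exponential comparison for a `Δ`-differentiable function, measured by a seminorm. -/
lemma seminorm_le_exp (hT : IsTimeScale T) (N : Seminorm ℝ E) {C : ℝ} (hC : 0 < C)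
    (hN : ∀ x, N x ≤ C * ‖x‖) {t₀ p b K l l' : ℝ} (hp : p ∈ T) (hb : b ∈ T) (ht₀ : t₀ ≤ p)
    (hpb : p ≤ b) (hK : 0 < K) (hl : l < l') {x w : ℝ → E} (H : ℝ → ℝ)
    (hx : ContinuousOn x (T ∩ Icc p b))
    (hw : ∀ t ∈ T, p ≤ t → t < b → HasDeltaDerivAt (ray T t₀) x (w t) t)
    (hH : ∀ t ∈ T, p ≤ t → t < b → 0 < H t ∧ mu T t ≤ H t ∧ 0 ≤ 1 + l * H t)
    (hstep : ∀ t ∈ T, p ≤ t → t < b → N (x t) ≤ K * Real.exp (l' * (t - p)) →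
      ∀ h, 0 ≤ h → h ≤ H t → N (x t + h • w t) ≤ (1 + l * h) * N (x t))
    (h0 : N (x p) ≤ K) :
    N (x b) ≤ K * Real.exp (l' * (b - p)) := by
  set φ : ℝ → ℝ := fun t => K * Real.exp (l' * (t - p)) with hφ
  have hφpos : ∀ t, 0 < φ t := fun t => by positivity
  have hφstep : ∀ t s, (1 + l' * (s - t)) * φ t ≤ φ s := by
    intro t s
    have e : φ s = Real.exp (l' * (s - t)) * φ t := by
      simp only [hφ]
      rw [mul_left_comm, ← Real.exp_add]
      ring_nf
    rw [e]
    refine mul_le_mul_of_nonneg_right ?_ (hφpos t).le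
    linarith [Real.add_one_le_exp (l' * (s - t))]
  have hlin : ∀ t ∈ T, p ≤ t → t < b → ∀ h, 0 ≤ h → h ≤ H t → 0 ≤ 1 + l * h := by
    intro t ht hpt htb h h0 hh
    obtain ⟨a1, -, a3⟩ := hH t ht hpt htb
    rcases le_total 0 l with h' | h'
    · positivity
    · nlinarith
  have hNc : Continuous N := by
    refine Seminorm.continuous_of_le (q := C.toNNReal • normSeminorm ℝ E) ?_ ?_
    · exact (continuous_norm.const_smul C.toNNReal)
    · intro x
      rw [smul_apply, NNReal.smul_def, Real.coe_toNNReal _ hC.le]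
      exact hN x
  refine le_of_forall_step (u := fun t => N (x t)) (φ := φ) hT hp hb hpb
    (hNc.comp_continuousOn hx) (by fun_prop) (by simpa [hφ] using h0) ?_ ?_
  · intro t ht hpt htb hs hle
    have hd := (hw t ht hpt htb).apply_sigma ⟨ht, ht₀.trans hpt⟩
    rw [sigma_ray (ht₀.trans hpt)] at hd
    obtain ⟨-, a2, -⟩ := hH t ht hpt htb
    have hm := mu_nonneg hT t
    have h1 := hstep t ht hpt htb hle (mu T t) hm a2
    have h2 := hlin t ht hpt htb (mu T t) hm a2
    have h3 := hφstep t (sigma T t)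
    change N (x (sigma T t)) ≤ _
    rw [hd]
    change (1 + l' * mu T t) * φ t ≤ _ at h3
    change N (x t + mu T t • w t) ≤ _
    have h4 := mul_le_mul_of_nonneg_left hle h2
    have h5 : (1 + l * mu T t) * φ t ≤ (1 + l' * mu T t) * φ t := by
      refine mul_le_mul_of_nonneg_right ?_ (hφpos t).le
      nlinarith
    linarith
  · intro t ht hpt htb hs hle
    -- The gap between the rates l and l' absorbs the differentiation error at a right-dense point.
    have hη : 0 < (l' - l) * φ t / C := div_pos (mul_pos (sub_pos.2 hl) (hφpos t)) hC
    have hd := hw t ht hpt htb _ hη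
    rw [sigma_ray (ht₀.trans hpt), hs, eventually_nhdsWithin_iff] at hd
    obtain ⟨a1, -, -⟩ := hH t ht hpt htb
    have hnear : ∀ᶠ s in 𝓝 t, s < t + H t := eventually_lt_nhds (by linarith)
    filter_upwards [hd, hnear] with s h1 h2 hsT hts
    have h3 := h1 ⟨hsT, ht₀.trans (hpt.trans hts.le)⟩
    have e : x s = (x t + (s - t) • w t) + -((x t - x s) - (t - s) • w t) := by module
    have h4 : N (x s) ≤ N (x t + (s - t) • w t) + N ((x t - x s) - (t - s) • w t) := by
      conv_lhs => rw [e]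
      refine (map_add_le_add N _ _).trans ?_
      rw [map_neg_eq_map]
    have h5 := hstep t ht hpt htb hle (s - t) (by linarith) (by linarith)
    have h6 := hlin t ht hpt htb (s - t) (by linarith) (by linarith)
    have h7 : N ((x t - x s) - (t - s) • w t) ≤ (l' - l) * φ t * (s - t) := by
      refine (hN _).trans ((mul_le_mul_of_nonneg_left h3 hC.le).trans_eq ?_)
      rw [abs_of_neg (by linarith)]
      field_simp
      ring
    have h8 := hφstep t s
    have h9 := mul_le_mul_of_nonneg_left hle h6
    change N (x s) ≤ φ s
    change _ ≤ (1 + l * (s - t)) * φ t at h9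
    linarith

end Comparison

/-! ### Strong stability and the adapted norm -/

section AdaptedNorm

/-- In a complex Banach algebra, the powers of an element whose spectrum lies in the open unit disc
tend to zero. -/
lemma tendsto_norm_pow_zero_of_spectrum {R : Type*} [NormedRing R] [NormedAlgebra ℂ R]
    [CompleteSpace R] [Nontrivial R] {a : R} (ha : ∀ z ∈ spectrum ℂ a, ‖z‖ < 1) :
    Tendsto (fun k : ℕ => ‖a ^ k‖) atTop (𝓝 0) := by
  have h1 : spectralRadius ℂ a < 1 := by
    have := spectrum.spectralRadius_lt_of_forall_lt (r := 1) a fun z hz => by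
      rw [← NNReal.coe_lt_coe]
      simpa using ha z hz
    simpa using this
  obtain ⟨q, hq1, hq2⟩ := ENNReal.lt_iff_exists_nnreal_btwn.1 h1
  have hq : (q : ℝ) < 1 := by exact_mod_cast hq2
  -- Gelfand's formula: eventually ‖a ^ k‖ ≤ q ^ k with q < 1.
  have hg := (spectrum.pow_nnnorm_pow_one_div_tendsto_nhds_spectralRadius a).eventually_lt_const hq1
  refine squeeze_zero' (Eventually.of_forall fun _ => norm_nonneg _) ?_
    (tendsto_pow_atTop_nhds_zero_of_lt_one q.2 hq)
  filter_upwards [hg, eventually_gt_atTop 0] with k hk hk0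
  have hk' : ((‖a ^ k‖₊ : ENNReal) ^ (1 / k : ℝ)) ^ k ≤ (q : ENNReal) ^ k :=
    pow_le_pow_left₀ (zero_le) hk.le k
  rw [← ENNReal.rpow_natCast, ← ENNReal.rpow_mul, one_div,
    inv_mul_cancel₀ (by exact_mod_cast hk0.ne'), ENNReal.rpow_one] at hk'
  exact_mod_cast hk'

/-- The isometric inclusion of ℝⁿ in ℂⁿ intertwines B with its complexification; this transfers
spectral information over ℂ to a real norm bound. -/
lemma norm_toEuclideanCLM_le {n : ℕ} (B : Matrix (Fin n) (Fin n) ℝ)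
    (x : EuclideanSpace ℝ (Fin n)) :
    ‖Matrix.toEuclideanCLM (𝕜 := ℝ) B x‖ ≤
      ‖Matrix.toEuclideanCLM (𝕜 := ℂ) (B.map Complex.ofReal)‖ * ‖x‖ := by
  have hn : ∀ y : EuclideanSpace ℝ (Fin n),
      ‖(WithLp.toLp 2 fun i => (y i : ℂ) : EuclideanSpace ℂ (Fin n))‖ = ‖y‖ := by
    intro y
    simp [EuclideanSpace.norm_eq]
  have he : Matrix.toEuclideanCLM (𝕜 := ℂ) (B.map Complex.ofReal) (WithLp.toLp 2 fun i => (x i : ℂ))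
      = WithLp.toLp 2 fun i => ((Matrix.toEuclideanCLM (𝕜 := ℝ) B x i : ℝ) : ℂ) := by
    ext i
    simp [Matrix.mulVec, dotProduct, Matrix.ofLp_toEuclideanCLM]
  rw [← hn, ← he, ← hn x]
  exact ContinuousLinearMap.le_opNorm _ _

/-- If all complex eigenvalues of a real matrix lie in the open unit disc, some power of it is a
strict contraction. -/
lemma exists_pow_contraction {n : ℕ} (hn : 0 < n) (B : Matrix (Fin n) (Fin n) ℝ)
    (hB : ∀ z : ℂ, Module.End.HasEigenvalue (Matrix.toLin' (B.map Complex.ofReal)) z → ‖z‖ < 1) :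
    ∃ m : ℕ, 0 < m ∧ ∀ x, ‖(Matrix.toEuclideanCLM (𝕜 := ℝ) B ^ m) x‖ ≤ 1 / 2 * ‖x‖ := by
  have : Nonempty (Fin n) := ⟨⟨0, hn⟩⟩
  have hspec : ∀ z ∈ spectrum ℂ (Matrix.toEuclideanCLM (𝕜 := ℂ) (B.map Complex.ofReal)),
      ‖z‖ < 1 := by
    intro z hz
    rw [AlgEquiv.spectrum_eq (Matrix.toEuclideanCLM (𝕜 := ℂ) (n := Fin n)),
      ← Matrix.spectrum_toLin'] at hz
    exact hB z (Module.End.hasEigenvalue_iff_mem_spectrum.2 hz)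
  have ht := tendsto_norm_pow_zero_of_spectrum hspec
  obtain ⟨m, hm, hm0⟩ :=
    ((ht.eventually_lt_const (by norm_num : (0 : ℝ) < 1 / 2)).and (eventually_gt_atTop 0)).exists
  refine ⟨m, hm0, fun x => ?_⟩
  have h1 := norm_toEuclideanCLM_le (B ^ m) x
  have h2 : (B ^ m).map Complex.ofReal = (B.map Complex.ofReal) ^ m :=
    map_pow (Complex.ofRealHom.mapMatrix) B m
  rw [h2, map_pow, map_pow] at h1
  exact h1.trans (mul_le_mul_of_nonneg_right hm.le (norm_nonneg _))

/-- A norm adapted to a linear map some power of which is a contraction. -/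
lemma exists_adapted_seminorm {E : Type*} [NormedAddCommGroup E] [NormedSpace ℝ E] (B : E →L[ℝ] E)
    {m : ℕ} (hm : 0 < m) (hB : ∀ x, ‖(B ^ m) x‖ ≤ 1 / 2 * ‖x‖) :
    ∃ (N : Seminorm ℝ E) (C : ℝ), 1 ≤ C ∧ (∀ x, ‖x‖ ≤ N x) ∧ (∀ x, N x ≤ C * ‖x‖) ∧
      ∀ x, N (B x) ≤ N x - 1 / 2 * ‖x‖ := by
  -- Passing from x to Bx telescopes: the term ‖x‖ is lost and ‖B ^ m x‖ ≤ ‖x‖ / 2 is gained.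
  let N : Seminorm ℝ E :=
    ∑ k ∈ Finset.range m, (normSeminorm ℝ E).comp ((B ^ k : E →L[ℝ] E) : E →ₗ[ℝ] E)
  have hN : ∀ x, N x = ∑ k ∈ Finset.range m, ‖(B ^ k) x‖ := by
    intro x
    simp only [N, sum_apply]
    rfl
  refine ⟨N, 1 + ∑ k ∈ Finset.range m, ‖B ^ k‖, le_add_of_nonneg_right (by positivity), fun x => ?_, fun x => ?_,
    fun x => ?_⟩
  · rw [hN]
    have := Finset.single_le_sum (f := fun k => ‖(B ^ k) x‖) (fun i _ => norm_nonneg _)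
      (Finset.mem_range.2 hm)
    simpa using this
  · rw [hN, add_mul, Finset.sum_mul, one_mul]
    have : ∑ k ∈ Finset.range m, ‖(B ^ k) x‖ ≤ ∑ k ∈ Finset.range m, ‖B ^ k‖ * ‖x‖ :=
      Finset.sum_le_sum fun k _ => ContinuousLinearMap.le_opNorm _ _
    linarith [norm_nonneg x]
  · have h1 : N (B x) = ∑ k ∈ Finset.range m, ‖(B ^ (k + 1)) x‖ := by
      rw [hN]
      refine Finset.sum_congr rfl fun k _ => ?_
      rw [pow_succ]
      rfl
    have h2 := Finset.sum_range_succ (fun k => ‖(B ^ k) x‖) m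
    rw [Finset.sum_range_succ'] at h2
    rw [h1, hN]
    have h3 := hB x
    simp only [pow_zero, one_apply_eq_self] at h2
    linarith

lemma neBot_atTop_inf_rightScattered {T : Set ℝ} (hT : IsTimeScale T) :
    (atTop ⊓ 𝓟 (rightScattered T)).NeBot := by
  rw [inf_principal_neBot_iff]
  intro U hU
  obtain ⟨a, ha⟩ := mem_atTop_sets.1 hU
  obtain ⟨s, hs, has⟩ := not_bddAbove_iff.1 hT.not_bddAbove a
  exact ⟨s, ha s has.le, hs⟩

/-- With b < 0 strictly above the limsup, 2 Re z + μ|z|² < b eventually. This excludes z = 0 and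
bounds μ by the M that solves 2 Re z + M|z|² = b, for which |1 + Mz|² = 1 + Mb < 1. -/
lemma eventually_mu_lt {T : Set ℝ} {z : ℂ} (hz : limsup (fun t : ℝ =>
      (((‖1 + (mu T t : ℂ) * z‖ ^ 2 - 1) / mu T t : ℝ) : EReal))
      (atTop ⊓ 𝓟 (rightScattered T)) < 0) (hT : IsTimeScale T) :
    ∃ M : ℝ, 0 < M ∧ ‖1 + (M : ℂ) * z‖ < 1 ∧
      ∀ᶠ t in atTop ⊓ 𝓟 (rightScattered T), mu T t < M := by
  have hexp : ∀ h : ℝ, ‖1 + (h : ℂ) * z‖ ^ 2 = 1 + h * (2 * z.re + h * ‖z‖ ^ 2) := by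
    intro h
    rw [← Complex.normSq_eq_norm_sq, ← Complex.normSq_eq_norm_sq, Complex.normSq_apply,
      Complex.normSq_apply]
    simp
    ring
  obtain ⟨b, hb1, hb2⟩ := EReal.lt_iff_exists_real_btwn.1 hz
  have hb : b < 0 := by exact_mod_cast hb2
  have hev := eventually_lt_of_limsup_lt hb1
  have hev' : ∀ᶠ t in atTop ⊓ 𝓟 (rightScattered T),
      0 < mu T t ∧ 2 * z.re + mu T t * ‖z‖ ^ 2 < b := by
    have hS : ∀ᶠ t in atTop ⊓ 𝓟 (rightScattered T), t ∈ rightScattered T :=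
      mem_inf_of_right (mem_principal_self _)
    filter_upwards [hev, hS] with t h1 h2
    have hm : 0 < mu T t := sub_pos.2 h2.2
    have h3 := EReal.coe_lt_coe_iff.1 h1
    rw [hexp, add_sub_cancel_left, mul_div_cancel_left₀ _ hm.ne'] at h3
    exact ⟨hm, h3⟩
  have := neBot_atTop_inf_rightScattered hT
  obtain ⟨t, ht0, ht⟩ := hev'.exists
  have hz0 : 0 < ‖z‖ ^ 2 := by
    rcases eq_or_ne z 0 with rfl | h
    · simp at ht
      linarith
    · positivity
  have key : ∀ t, 2 * z.re + mu T t * ‖z‖ ^ 2 < b → mu T t < (b - 2 * z.re) / ‖z‖ ^ 2 := by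
    intro t ht
    rw [lt_div_iff₀ hz0]
    linarith
  refine ⟨(b - 2 * z.re) / ‖z‖ ^ 2, ht0.trans (key t ht), ?_, hev'.mono fun s hs => key s hs.2⟩
  have hM := ht0.trans (key t ht)
  have h2 := hexp ((b - 2 * z.re) / ‖z‖ ^ 2)
  rw [div_mul_cancel₀ _ hz0.ne'] at h2
  nlinarith [norm_nonneg (1 + (((b - 2 * z.re) / ‖z‖ ^ 2 : ℝ) : ℂ) * z)]

/-- The discs `|1 + M z| < 1` shrink with `M`. -/
lemma norm_one_add_mul_lt_one {z : ℂ} {M M' : ℝ} (hM : 0 < M) (hMM' : M ≤ M')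
    (h : ‖1 + (M' : ℂ) * z‖ < 1) : ‖1 + (M : ℂ) * z‖ < 1 := by
  have hM' := hM.trans_le hMM'
  -- A convex combination of 1 and 1 + M'z, with positive weight on the latter.
  have e : 1 + (M : ℂ) * z = ((1 - M / M' : ℝ) : ℂ) + ((M / M' : ℝ) : ℂ) * (1 + (M' : ℂ) * z) := by
    have : (M' : ℂ) ≠ 0 := by exact_mod_cast hM'.ne'
    push_cast
    field_simp
    ring
  have h1 : 0 < M / M' := by positivity
  have h2 : M / M' ≤ 1 := (div_le_one hM').2 hMM'
  rw [e]
  refine (norm_add_le _ _).trans_lt ?_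
  rw [norm_mul, Complex.norm_real, Complex.norm_real, Real.norm_of_nonneg (by linarith),
    Real.norm_of_nonneg h1.le]
  nlinarith

/-- There are finitely many eigenvalues, and the least of their individual bounds serves all of them
by `norm_one_add_mul_lt_one`. -/
lemma StronglyStable.exists_bound {T : Set ℝ} (hT : IsTimeScale T) {n : ℕ} (hn : 0 < n)
    {A : Matrix (Fin n) (Fin n) ℝ} (hA : StronglyStable T A) :
    ∃ M : ℝ, 0 < M ∧ (∀ᶠ t in atTop ⊓ 𝓟 (rightScattered T), mu T t ≤ M) ∧
      ∀ z : ℂ, Module.End.HasEigenvalue (Matrix.toLin' (A.map Complex.ofReal)) z →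
        ‖1 + (M : ℂ) * z‖ < 1 := by
  have : Nonempty (Fin n) := ⟨⟨0, hn⟩⟩
  have hex : ∀ z : ℂ, ∃ M : ℝ,
      Module.End.HasEigenvalue (Matrix.toLin' (A.map Complex.ofReal)) z →
      0 < M ∧ ‖1 + (M : ℂ) * z‖ < 1 ∧ ∀ᶠ t in atTop ⊓ 𝓟 (rightScattered T), mu T t < M := by
    intro z
    by_cases hz : Module.End.HasEigenvalue (Matrix.toLin' (A.map Complex.ofReal)) z
    · obtain ⟨M, hM⟩ := eventually_mu_lt (hA z hz) hT
      exact ⟨M, fun _ => hM⟩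
    · exact ⟨0, fun h => absurd h hz⟩
  choose M hM using hex
  have hfin := Module.End.finite_hasEigenvalue (Matrix.toLin' (A.map Complex.ofReal))
  obtain ⟨z₀, hz₀⟩ := Module.End.exists_eigenvalue (Matrix.toLin' (A.map Complex.ofReal))
  obtain ⟨w, hw, hmin⟩ := hfin.exists_minimalFor M _ ⟨z₀, hz₀⟩
  have hw' := hM w hw
  refine ⟨M w, hw'.1, hw'.2.2.mono fun _ h => h.le, fun z hz => ?_⟩
  rcases le_total (M w) (M z) with h | h
  · exact norm_one_add_mul_lt_one hw'.1 h (hM z hz).2.1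
  · exact norm_one_add_mul_lt_one hw'.1 (hmin hz h) (hM z hz).2.1

lemma hasEigenvalue_of_one_add_smul {n : ℕ} {A : Matrix (Fin n) (Fin n) ℝ} {M : ℝ} (hM : M ≠ 0)
    {z : ℂ} (hz : Module.End.HasEigenvalue (Matrix.toLin' ((1 + M • A).map Complex.ofReal)) z) :
    Module.End.HasEigenvalue (Matrix.toLin' (A.map Complex.ofReal)) ((z - 1) / M) := by
  obtain ⟨v, hv⟩ := hz.exists_hasEigenvector
  refine Module.End.hasEigenvalue_of_hasEigenvector (x := v) ⟨?_, hv.2⟩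
  have h1 := hv.apply_eq_smul
  rw [Module.End.mem_eigenspace_iff]
  have hM' : (M : ℂ) ≠ 0 := by exact_mod_cast hM
  have h2 : (1 + M • A).map Complex.ofReal = 1 + (M : ℂ) • A.map Complex.ofReal := by
    ext i j
    by_cases hij : i = j <;> simp [hij]
  rw [h2, map_add, map_smul, Matrix.toLin'_one, LinearMap.add_apply, LinearMap.id_apply,
    LinearMap.smul_apply] at h1
  have h3 : (M : ℂ) • Matrix.toLin' (A.map Complex.ofReal) v = (z - 1) • v := by
    rw [sub_smul, one_smul, ← h1, add_sub_cancel_left]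
  rw [div_eq_inv_mul, mul_smul, ← h3, smul_smul, inv_mul_cancel₀ hM', one_smul]

/-- A seminorm equivalent to the norm that decreases along every step `x ↦ x + h A x`
with `0 ≤ h ≤ M`, where `M` eventually bounds the graininess. -/
lemma StronglyStable.exists_seminorm {T : Set ℝ} (hT : IsTimeScale T) {n : ℕ} (hn : 0 < n)
    {A : Matrix (Fin n) (Fin n) ℝ} (hA : StronglyStable T A) :
    ∃ (N : Seminorm ℝ (EuclideanSpace ℝ (Fin n))) (C M t₁ : ℝ), 1 ≤ C ∧ 0 < M ∧
      (∀ x, ‖x‖ ≤ N x) ∧ (∀ x, N x ≤ C * ‖x‖) ∧ (∀ t, t₁ ≤ t → t ∈ T → mu T t ≤ M) ∧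
      ∀ x h, 0 ≤ h → h ≤ M →
        N (x + h • Matrix.toEuclideanLin A x) ≤ N x - h / (2 * M) * ‖x‖ := by
  obtain ⟨M, hM, hmu, hspec⟩ := hA.exists_bound hT hn
  obtain ⟨m, hm, hpow⟩ := exists_pow_contraction hn (1 + M • A) fun z hz => by
    have := hspec _ (hasEigenvalue_of_one_add_smul hM.ne' hz)
    have hM' : (M : ℂ) ≠ 0 := by exact_mod_cast hM.ne'
    rwa [mul_div_cancel₀ _ hM', add_sub_cancel] at this
  obtain ⟨N, C, hC, hN1, hN2, hN3⟩ := exists_adapted_seminorm _ hm hpow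
  rw [eventually_inf_principal, eventually_atTop] at hmu
  obtain ⟨t₁, ht₁⟩ := hmu
  refine ⟨N, C, M, t₁, hC, hM, hN1, hN2, fun t ht htT => ?_, fun x h h0 hh => ?_⟩
  · rcases (le_sigma hT t).lt_or_eq with hs | hs
    · exact ht₁ t ht ⟨htT, hs⟩
    · rw [mu, ← hs, sub_self]
      exact hM.le
  · have hBx : Matrix.toEuclideanCLM (𝕜 := ℝ) (1 + M • A) x
        = x + M • Matrix.toEuclideanLin A x := by
      rw [map_add, map_one, map_smul]
      rfl
    have h3 := hN3 x
    rw [hBx] at h3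
    have hle : h / M ≤ 1 := (div_le_one hM).2 hh
    have hnn : 0 ≤ h / M := by positivity
    -- Convexity of N passes the decrease under the full step M to shorter steps, in proportion to h
    -- / M.
    have e : x + h • Matrix.toEuclideanLin A x
        = (1 - h / M) • x + (h / M) • (x + M • Matrix.toEuclideanLin A x) := by
      rw [smul_add, smul_smul, div_mul_cancel₀ _ hM.ne']
      module
    rw [e]
    refine (map_add_le_add N _ _).trans ?_
    rw [map_smul_eq_mul, map_smul_eq_mul, Real.norm_of_nonneg (by linarith),
      Real.norm_of_nonneg hnn]
    have h4 := mul_le_mul_of_nonneg_left h3 hnn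
    have e2 : h / (2 * M) = h / M * (1 / 2) := by field_simp
    rw [e2]
    linarith

end AdaptedNorm

/-! ### Euler polygons and Peano's theorem -/

section Existence

variable {T : Set ℝ} {E : Type*} [NormedAddCommGroup E] [NormedSpace ℝ E]

/-- `x` is an `e`-approximate solution of `x^Δ = F(t, x)` on `T ∩ [a, b]`: its increment over
`[s, t]` is an average of values of `F` along `x` on `T ∩ [s - e, t)`. -/
def IsApproxSolution (T : Set ℝ) (F : ℝ → E → E) (e a b : ℝ) (x : ℝ → E) : Prop :=
  ∀ s ∈ T, ∀ t ∈ T, a ≤ s → s ≤ t → t ≤ b → ∀ (v : E) (η : ℝ),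
    (∀ u ∈ T, a ≤ u → s - e ≤ u → u < t → ‖F u (x u) - v‖ ≤ η) →
      ‖x t - x s - (t - s) • v‖ ≤ η * (t - s)

/-- The first point of `T` at or after `c`. -/
lemma exists_first_ge (hT : IsTimeScale T) (c : ℝ) :
    ∃ q ∈ T, c ≤ q ∧ ∀ s ∈ T, s < q → s < c := by
  obtain ⟨t, ht, hct⟩ := hT.exists_gt c
  have hbd : BddBelow (T ∩ Ici c) := ⟨c, fun _ h => h.2⟩
  have hm := (hT.isClosed.inter isClosed_Ici).csInf_mem ⟨t, ht, hct.le⟩ hbd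
  refine ⟨_, hm.1, hm.2, fun s hs hsq => ?_⟩
  by_contra! hcs
  exact absurd (csInf_le hbd ⟨hs, hcs⟩) (not_le.2 hsq)

/-- One Euler step with slope frozen at p. By `hpq`, points of T before q lie within e of p, so p
belongs to the averaging window; an interval straddling p is split there. -/
lemma IsApproxSolution.extend {F : ℝ → E → E} {e a p q : ℝ} (he : 0 < e) (hp : p ∈ T)
    (hap : a ≤ p) (hpq : ∀ s ∈ T, s < q → s < p + e) {x : ℝ → E}
    (hx : IsApproxSolution T F e a p x) :
    ∃ y : ℝ → E, y a = x a ∧ IsApproxSolution T F e a q y := by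
  set y : ℝ → E := fun t => if t ≤ p then x t else x p + (t - p) • F p (x p) with hy
  have hyl : ∀ t, t ≤ p → y t = x t := fun t ht => if_pos ht
  have hyr : ∀ t, p ≤ t → y t = x p + (t - p) • F p (x p) := by
    intro t ht
    rcases ht.lt_or_eq with h | rfl
    · exact if_neg (not_le.2 h)
    · rw [hyl p le_rfl, sub_self, zero_smul, add_zero]
  refine ⟨y, hyl a hap, fun s hs t ht has hst htq v η hv => ?_⟩
  rcases le_total t p with htp | hpt
  · rw [hyl t htp, hyl s (hst.trans htp)]
    refine hx s hs t ht has hst htp v η fun u hu h1 h2 h3 => ?_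
    rw [← hyl u (h3.le.trans htp)]
    exact hv u hu h1 h2 h3
  rcases le_total p s with hps | hsp
  · rw [hyr t hpt, hyr s hps]
    have eq : x p + (t - p) • F p (x p) - (x p + (s - p) • F p (x p)) - (t - s) • v
        = (t - s) • (F p (x p) - v) := by module
    rw [eq, norm_smul, Real.norm_of_nonneg (sub_nonneg.2 hst), mul_comm]
    rcases hst.lt_or_eq with hlt | rfl
    · refine mul_le_mul_of_nonneg_right ?_ (sub_nonneg.2 hst)
      have h1 := hpq s hs (hlt.trans_le htq)
      have := hv p hp hap (by linarith) (hps.trans_lt hlt)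
      rwa [hyl p le_rfl] at this
    · simp
  · rw [hyr t hpt, hyl s hsp]
    rcases hpt.lt_or_eq with hlt | rfl
    · have h1 : ‖x p - x s - (p - s) • v‖ ≤ η * (p - s) := by
        refine hx s hs p hp has hsp le_rfl v η fun u hu h1 h2 h3 => ?_
        rw [← hyl u h3.le]
        exact hv u hu h1 h2 (h3.trans hlt)
      have h2 := hv p hp hap (by linarith) hlt
      rw [hyl p le_rfl] at h2
      have eq : x p + (t - p) • F p (x p) - x s - (t - s) • v
          = (x p - x s - (p - s) • v) + (t - p) • (F p (x p) - v) := by module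
      rw [eq]
      refine (norm_add_le _ _).trans ?_
      rw [norm_smul, Real.norm_of_nonneg (sub_nonneg.2 hpt)]
      have h3 := mul_le_mul_of_nonneg_left h2 (sub_nonneg.2 hpt)
      linarith
    · rw [sub_self, zero_smul, add_zero]
      refine hx s hs p hp has hst le_rfl v η fun u hu h1 h2 h3 => ?_
      rw [← hyl u h3.le]
      exact hv u hu h1 h2 h3

/-- Each Euler step ends at the first point of T at distance at least e, so large gaps are crossed
in one step and k steps advance by at least k * e. -/
lemma exists_isApproxSolution (hT : IsTimeScale T) (F : ℝ → E → E) {e a : ℝ} (he : 0 < e)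
    (ha : a ∈ T) (x₀ : E) (k : ℕ) :
    ∃ b ∈ T, a + k * e ≤ b ∧ ∃ x : ℝ → E, x a = x₀ ∧ IsApproxSolution T F e a b x := by
  induction k with
  | zero =>
    refine ⟨a, ha, by simp, fun _ => x₀, rfl, fun s _ t _ h1 h2 h3 v η _ => ?_⟩
    have hsa : s = a := le_antisymm (h2.trans h3) h1
    have hta : t = a := le_antisymm h3 (h1.trans h2)
    simp [hsa, hta]
  | succ k ih =>
    obtain ⟨p, hp, hpk, x, hxa, hx⟩ := ih
    have hap : a ≤ p := le_trans (by have := mul_nonneg k.cast_nonneg he.le; linarith) hpk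
    obtain ⟨q, hq, hpq, hq1⟩ := exists_first_ge hT (p + e)
    obtain ⟨y, hya, hy⟩ := hx.extend he hp hap hq1
    refine ⟨q, hq, ?_, y, by rw [hya, hxa], hy⟩
    push_cast
    linarith

lemma IsApproxSolution.norm_sub_le {F : ℝ → E → E} {e a b c K : ℝ} {x : ℝ → E}
    (hx : IsApproxSolution T F e a b x) (hcb : c ≤ b)
    (hK : ∀ t ∈ T, a ≤ t → t ≤ c → ∀ y, ‖F t y‖ ≤ K) {s t : ℝ} (hs : s ∈ ray T a)
    (ht : t ∈ ray T a) (hsc : s ≤ c) (htc : t ≤ c) : ‖x t - x s‖ ≤ K * |t - s| := by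
  have key : ∀ s ∈ ray T a, ∀ t ∈ ray T a, s ≤ t → t ≤ c → ‖x t - x s‖ ≤ K * (t - s) := by
    intro s hs t ht hst htc
    have := hx s hs.1 t ht.1 hs.2 hst (htc.trans hcb) 0 K fun u hu h1 _ h3 => by
      rw [sub_zero]
      exact hK u hu h1 (h3.le.trans htc) _
    rwa [smul_zero, sub_zero] at this
  rcases le_total s t with h | h
  · rw [abs_of_nonneg (sub_nonneg.2 h)]
    exact key s hs t ht h htc
  · rw [abs_sub_comm, abs_of_nonneg (sub_nonneg.2 h), norm_sub_rev]
    exact key t ht s hs h hsc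

/-- **Peano's theorem** on a time scale, for a continuous right-hand side that is bounded on each
segment of the time scale. -/
theorem exists_forall_hasDeltaDerivAt [ProperSpace E] (hT : IsTimeScale T) {F : ℝ → E → E} {a : ℝ}
    (ha : a ∈ T)
    (hF : ContinuousOn (fun p : ℝ × E => F p.1 p.2) (ray T a ×ˢ univ))
    (hbd : ∀ b, ∃ K, ∀ t ∈ T, a ≤ t → t ≤ b → ∀ y, ‖F t y‖ ≤ K) (x₀ : E) :
    ∃ x : ℝ → E, x a = x₀ ∧ ∀ t ∈ ray T a, HasDeltaDerivAt (ray T a) x (F t (x t)) t := by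
  have happ : ∀ k : ℕ, ∃ (b : ℝ) (x : ℝ → E), a + (k + 1) ≤ b ∧ x a = x₀ ∧
      IsApproxSolution T F (1 / ((k : ℝ) + 1)) a b x := by
    intro k
    have hk : (0 : ℝ) < k + 1 := by positivity
    obtain ⟨b, -, hb, x, hxa, hx⟩ :=
      -- (k + 1)² steps of size 1 / (k + 1) cover length k + 1, so the domains exhaust T as the mesh
      -- tends to 0.
      exists_isApproxSolution hT F (e := 1 / ((k : ℝ) + 1)) (by positivity) ha x₀ ((k + 1) ^ 2)
    refine ⟨b, x, le_trans (le_of_eq ?_) hb, hxa, hx⟩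
    push_cast
    field_simp
  choose b xs hb hxa hxs using happ
  have haR : a ∈ ray T a := ⟨ha, mem_Ici.2 le_rfl⟩
  -- The ultrafilter gives pointwise limits at all t at once, in place of Arzelà–Ascoli and a
  -- diagonal subsequence.
  have hle : (hyperfilter ℕ : Filter ℕ) ≤ atTop := Nat.hyperfilter_le_atTop
  have hbk : ∀ c : ℝ, ∀ᶠ k in (hyperfilter ℕ : Filter ℕ), c ≤ b k := by
    intro c
    refine hle ?_
    filter_upwards [eventually_ge_atTop ⌈c - a⌉₊] with k hk
    have := Nat.ceil_le.1 hk
    linarith [hb k]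
  have hek : ∀ c : ℝ, 0 < c → ∀ᶠ k : ℕ in (hyperfilter ℕ : Filter ℕ), 1 / ((k : ℝ) + 1) < c :=
    fun c hc => hle (tendsto_one_div_add_atTop_nhds_zero_nat.eventually_lt_const hc)
  have hlim : ∀ t, ∃ y, t ∈ ray T a →
      Tendsto (fun k => xs k t) (hyperfilter ℕ : Filter ℕ) (𝓝 y) := by
    intro t
    by_cases ht : t ∈ ray T a
    · obtain ⟨K, hK⟩ := hbd t
      have hmem : ∀ᶠ k in (hyperfilter ℕ : Filter ℕ),
          xs k t ∈ Metric.closedBall x₀ (K * |t - a|) := by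
        filter_upwards [hbk t] with k hk
        rw [mem_closedBall_iff_norm, ← hxa k]
        exact (hxs k).norm_sub_le hk hK haR ht ht.2 le_rfl
      obtain ⟨y, -, hy⟩ := (isCompact_closedBall x₀ (K * |t - a|)).ultrafilter_le_nhds'
        ((hyperfilter ℕ).map fun k => xs k t) hmem
      exact ⟨y, fun _ => hy⟩
    · exact ⟨0, fun h => absurd h ht⟩
  choose x hx using hlim
  refine ⟨x, ?_, fun s hs η hη => ?_⟩
  · refine tendsto_nhds_unique (hx a haR) ?_
    simp only [hxa]
    exact tendsto_const_nhds
  rw [sigma_ray hs.2]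
  set v := F s (x s) with hv
  set c := sigma T s + 1 with hc
  have hσ := le_sigma hT s
  have hσR : sigma T s ∈ ray T a := ⟨sigma_mem hT s, le_trans hs.2 hσ⟩
  obtain ⟨K₀, hK₀⟩ := hbd c
  set K := max K₀ 1 with hKdef
  have hK1 : 1 ≤ K := le_max_right _ _
  have hK : ∀ t ∈ T, a ≤ t → t ≤ c → ∀ y, ‖F t y‖ ≤ K :=
    fun t h1 h2 h3 y => (hK₀ t h1 h2 h3 y).trans (le_max_left _ _)
  obtain ⟨δ, hδ, hcont⟩ : ∃ δ > 0, ∀ u ∈ ray T a, ∀ y, |u - s| < δ → ‖y - x s‖ < δ →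
      ‖F u y - v‖ ≤ η := by
    obtain ⟨δ, hδ, h⟩ := Metric.continuousWithinAt_iff.1 (hF (s, x s) ⟨hs, mem_univ _⟩) η hη
    refine ⟨δ, hδ, fun u hu y h1 h2 => ?_⟩
    have := h (x := (u, y)) ⟨hu, mem_univ _⟩ (by
      rw [Prod.dist_eq, max_lt_iff, Real.dist_eq, dist_eq_norm]
      exact ⟨h1, h2⟩)
    rw [dist_eq_norm] at this
    exact this.le
  set δ' := δ / (2 * K) with hδ'
  have hδ'0 : 0 < δ' := by positivity
  have hKδ : K * δ' = δ / 2 := by rw [hδ']; field_simp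
  have hδδ : δ' < δ := by
    have : δ' ≤ K * δ' := le_mul_of_one_le_left hδ'0.le hK1
    linarith
  -- Convergence at s alone and the common Lipschitz constant K keep the polygons near x s for times
  -- near s; uniform convergence is not needed.
  have key : ∀ p ∈ ray T a, ∀ q ∈ ray T a, p ≤ q → q ≤ c → ∀ e₀ > 0,
      (∀ u ∈ ray T a, p - e₀ ≤ u → u < q → |u - s| < δ') →
      ‖x q - x p - (q - p) • v‖ ≤ η * (q - p) := by
    intro p hp q hq hpq hqc e₀ he₀ hu
    have hl : Tendsto (fun k => ‖xs k q - xs k p - (q - p) • v‖) (hyperfilter ℕ : Filter ℕ)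
        (𝓝 ‖x q - x p - (q - p) • v‖) :=
      (((hx q hq).sub (hx p hp)).sub tendsto_const_nhds).norm
    refine le_of_tendsto hl ?_
    have hnear := (hx s hs).eventually (Metric.ball_mem_nhds (x s) (half_pos hδ))
    filter_upwards [hbk c, hek e₀ he₀, hnear] with k h1 h2 h3
    refine hxs k p hp.1 q hq.1 hp.2 hpq (hqc.trans h1) v η fun u huT hau hpu huq => ?_
    have huR : u ∈ ray T a := ⟨huT, hau⟩
    have h4 := hu u huR (by linarith) huq
    refine hcont u huR _ (h4.trans hδδ) ?_
    have h5 := (hxs k).norm_sub_le h1 hK hs huR (by linarith) (huq.le.trans hqc)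
    have h6 : K * |u - s| ≤ K * δ' := mul_le_mul_of_nonneg_left h4.le (by linarith)
    rw [dist_eq_norm] at h3
    have h7 := norm_add_le (xs k u - xs k s) (xs k s - x s)
    rw [sub_add_sub_cancel] at h7
    linarith
  have hev : ∀ᶠ t in 𝓝 s, |t - s| < min (δ' / 2) 1 ∧ (s < sigma T s → t < sigma T s) := by
    have hball : ∀ᶠ t in 𝓝 s, t ∈ Metric.ball s (min (δ' / 2) 1) :=
      Metric.ball_mem_nhds s (by positivity)
    refine hball.and ?_
    by_cases h : s < sigma T s
    · exact (eventually_lt_nhds h).mono fun t ht _ => ht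
    · exact Eventually.of_forall fun t ht => absurd ht h
  rw [eventually_nhdsWithin_iff]
  filter_upwards [hev] with t ht htR
  obtain ⟨hts, htσ⟩ := ht
  rw [lt_min_iff, abs_lt, abs_lt] at hts
  obtain ⟨⟨h1, h2⟩, h3, h4⟩ := hts
  -- On [t, σ(s)) all points of T are at most s, hence near s even if the jump is large. The case t
  -- > σ(s) occurs only at a right-dense s.
  rcases le_or_gt t (sigma T s) with hle' | hgt
  · rw [abs_of_nonneg (sub_nonneg.2 hle')]
    refine key t htR _ hσR hle' (by linarith) (δ' / 4) (by positivity) fun u hu h5 h6 => ?_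
    have h7 := le_of_lt_sigma hu.1 h6
    rw [abs_lt]
    constructor <;> linarith
  · have hσs : sigma T s = s := by
      by_contra hne
      exact absurd (htσ (lt_of_le_of_ne hσ (Ne.symm hne))) (not_lt.2 hgt.le)
    rw [hσs] at hgt ⊢
    rw [abs_sub_comm, abs_of_nonneg (sub_nonneg.2 hgt.le), ← norm_neg]
    have h8 := key s hs t htR hgt.le (by linarith) (δ' / 4) (by positivity) fun u hu h5 h6 => by
      rw [abs_lt]
      constructor <;> linarith
    have h9 : -(x s - x t - (s - t) • v) = x t - x s - (t - s) • v := by module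
    rwa [h9]

end Existence

/-! ### A priori decay estimate and truncation -/

section Stability

/-- G depends on t₀ because it absorbs the growth before the graininess is bounded by M; ε and c
come from the adapted norm alone. A general derivative w lets the estimate apply to the truncated
equation as well. -/
lemma StronglyStable.exists_estimate {T : Set ℝ} (hT : IsTimeScale T) {n : ℕ}
    {A : Matrix (Fin n) (Fin n) ℝ} (hA : StronglyStable T A) :
    ∃ ε > 0, ∃ c > 0, ∀ t₀ ∈ T, ∃ G > 0,
      ∀ (ρ K b : ℝ) (x w : ℝ → EuclideanSpace ℝ (Fin n)), 0 < K → G * K < ρ →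
        ContinuousOn x (T ∩ Icc t₀ b) →
        (∀ t ∈ T, t₀ ≤ t → t < b → HasDeltaDerivAt (ray T t₀) x (w t) t ∧
          (‖x t‖ < ρ → ‖w t - Matrix.toEuclideanLin A (x t)‖ ≤ ε * ‖x t‖)) →
        ‖x t₀‖ ≤ K → ∀ t ∈ T ∩ Icc t₀ b, ‖x t‖ ≤ G * K * Real.exp (-c * (t - t₀)) := by
  rcases Nat.eq_zero_or_pos n with rfl | hn
  · refine ⟨1, one_pos, 1, one_pos, fun t₀ _ => ⟨1, one_pos, fun ρ K b x w hK _ _ _ _ t _ => ?_⟩⟩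
    rw [Subsingleton.elim (x t) 0, norm_zero]
    positivity
  obtain ⟨N, C, M, t₂, hC1, hM, hN1, hN2, hmu, hdec⟩ := hA.exists_seminorm hT hn
  have hC : 0 < C := by linarith
  -- The norm drops by h/(2M)‖x‖ = 4cCh‖x‖ and a perturbation with ε = 2c costs at most 2cCh‖x‖.
  -- What remains is at least 2ch N(x), and half of that rate is the slack for the comparison.
  set c := 1 / (8 * (M * C)) with hc
  have hc0 : 0 < c := by positivity
  have hcM : c * M = 1 / 8 / C := by rw [hc]; field_simp
  refine ⟨2 * c, by positivity, c, hc0, fun t₀ ht₀ => ?_⟩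
  obtain ⟨t₁, ht₁, ht₁'⟩ := hT.exists_gt (max t₀ t₂)
  have h01 : t₀ ≤ t₁ := (le_max_left _ _).trans ht₁'.le
  have h21 : t₂ ≤ t₁ := (le_max_right _ _).trans ht₁'.le
  set a := ‖Matrix.toEuclideanCLM (𝕜 := ℝ) A‖ with ha
  have hAx : ∀ x, ‖Matrix.toEuclideanLin A x‖ ≤ a * ‖x‖ :=
    fun x => (Matrix.toEuclideanCLM (𝕜 := ℝ) A).le_opNorm x
  set L := C * (a + 2 * c) with hL
  have hL0 : 0 ≤ L := by positivity
  -- The extra c offsets the factor exp(-c(t - t₀)), required already on [t₀, t₁].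
  refine ⟨C * Real.exp ((L + 1 + c) * (t₁ - t₀)), by positivity, ?_⟩
  intro ρ K b x w hK hGK hx hw h0
  have hsmall : ∀ s, s ≤ t₁ → C * K * Real.exp ((L + 1) * (s - t₀)) < ρ := by
    intro s hs
    refine lt_of_le_of_lt ?_ hGK
    rw [mul_right_comm C _ K]
    gcongr C * K * Real.exp ?_
    nlinarith
  have hform : ∀ t, C * Real.exp ((L + 1 + c) * (t₁ - t₀)) * K * Real.exp (-c * (t - t₀))
      = C * K * Real.exp ((L + 1 + c) * (t₁ - t₀) + -c * (t - t₀)) := by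
    intro t
    rw [Real.exp_add]
    ring
  have hgrow : ∀ t ∈ T, t₀ ≤ t → t ≤ b → t ≤ t₁ →
      N (x t) ≤ C * K * Real.exp ((L + 1) * (t - t₀)) := by
    intro t ht h0t htb ht1
    refine seminorm_le_exp hT N hC hN2 (l := L) ht₀ ht le_rfl h0t (by positivity) (by linarith)
      -- The added 1 leaves room for positive steps at right-dense points.
      (fun s => mu T s + 1) (hx.mono fun s hs => ⟨hs.1, hs.2.1, hs.2.2.trans htb⟩)
      (fun s hs h1 h2 => (hw s hs h1 (h2.trans_le htb)).1) ?_ ?_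
      ((hN2 _).trans (mul_le_mul_of_nonneg_left h0 hC.le))
    · intro s _ _ _
      have := mu_nonneg hT s
      exact ⟨by linarith, by linarith, by positivity⟩
    · intro s hs h1 h2 h3 h hh _
      have hlt : ‖x s‖ < ρ := (hN1 _).trans_lt (h3.trans_lt (hsmall s (h2.le.trans ht1)))
      have hf := (hw s hs h1 (h2.trans_le htb)).2 hlt
      have hws : ‖w s‖ ≤ (a + 2 * c) * ‖x s‖ := by
        have := norm_add_le (w s - Matrix.toEuclideanLin A (x s)) (Matrix.toEuclideanLin A (x s))
        rw [sub_add_cancel] at this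
        linarith [hAx (x s)]
      refine (map_add_le_add N _ _).trans ?_
      rw [map_smul_eq_mul, Real.norm_of_nonneg hh]
      have h4 : N (w s) ≤ L * N (x s) := by
        refine (hN2 _).trans ((mul_le_mul_of_nonneg_left hws hC.le).trans ?_)
        rw [← mul_assoc]
        exact mul_le_mul_of_nonneg_left (hN1 _) hL0
      have h5 := mul_le_mul_of_nonneg_left h4 hh
      linarith
  rintro t ⟨ht, h0t, htb⟩
  refine (hN1 _).trans ?_
  rcases le_total t t₁ with ht1 | ht1
  · refine (hgrow t ht h0t htb ht1).trans ?_
    rw [hform]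
    gcongr C * K * Real.exp ?_
    nlinarith
  · have hstart := hgrow t₁ ht₁ h01 (ht1.trans htb) le_rfl
    set K₁ := C * K * Real.exp ((L + 1) * (t₁ - t₀)) with hK₁
    have hK₁0 : 0 < K₁ := by positivity
    have hK₁ρ : K₁ < ρ := hsmall t₁ le_rfl
    have hend : N (x t) ≤ K₁ * Real.exp (-c * (t - t₁)) := by
      refine seminorm_le_exp hT N hC hN2 (l := -(2 * c)) ht₁ ht h01 ht1 hK₁0 (by linarith)
        (fun _ => M) (hx.mono fun s hs => ⟨hs.1, h01.trans hs.2.1, hs.2.2.trans htb⟩)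
        (fun s hs h1 h2 => (hw s hs (h01.trans h1) (h2.trans_le htb)).1) ?_ ?_ hstart
      · intro s hs h1 _
        refine ⟨hM, hmu s (h21.trans h1) hs, ?_⟩
        have : 1 / 8 / C ≤ 1 / 8 := div_le_self (by norm_num) hC1
        linarith
      · intro s hs h1 h2 h3 h hh hhM
        have hlt : ‖x s‖ < ρ := by
          refine (hN1 _).trans_lt (h3.trans_lt (lt_of_le_of_lt ?_ hK₁ρ))
          refine mul_le_of_le_one_right hK₁0.le (Real.exp_le_one_iff.2 ?_)
          nlinarith
        have hf := (hw s hs (h01.trans h1) (h2.trans_le htb)).2 hlt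
        have e : x s + h • w s = (x s + h • Matrix.toEuclideanLin A (x s))
            + h • (w s - Matrix.toEuclideanLin A (x s)) := by module
        rw [e]
        refine (map_add_le_add N _ _).trans ?_
        rw [map_smul_eq_mul, Real.norm_of_nonneg hh]
        have h4 := hdec (x s) h hh hhM
        have h5 := mul_le_mul_of_nonneg_left ((hN2 _).trans
          (mul_le_mul_of_nonneg_left hf hC.le)) hh
        have e1 : h / (2 * M) = 4 * (c * C) * h := by rw [hc]; field_simp; ring
        rw [e1] at h4
        have h6 := mul_le_mul_of_nonneg_left (hN2 (x s)) (mul_nonneg hc0.le hh)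
        linarith
    refine hend.trans (le_of_eq ?_)
    rw [hform, hK₁, mul_assoc (C * K), ← Real.exp_add]
    ring_nf

variable {E : Type*} [NormedAddCommGroup E] [NormedSpace ℝ E]

/-- Radial retraction onto the closed ball of radius `ρ`. -/
noncomputable def radialRetraction (ρ : ℝ) (x : E) : E := (ρ / max ρ ‖x‖) • x

lemma continuous_radialRetraction {ρ : ℝ} (hρ : 0 < ρ) :
    Continuous (radialRetraction ρ : E → E) := by
  unfold radialRetraction
  refine Continuous.smul (Continuous.div continuous_const (by fun_prop) fun x => ?_) continuous_id
  exact (lt_max_of_lt_left hρ).ne'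

lemma norm_radialRetraction_le {ρ : ℝ} (hρ : 0 < ρ) (x : E) : ‖radialRetraction ρ x‖ ≤ ρ := by
  have hm : 0 < max ρ ‖x‖ := lt_max_of_lt_left hρ
  rw [radialRetraction, norm_smul, Real.norm_of_nonneg (by positivity), div_mul_eq_mul_div,
    div_le_iff₀ hm]
  exact mul_le_mul_of_nonneg_left (le_max_right _ _) hρ.le

lemma radialRetraction_of_norm_le {ρ : ℝ} (hρ : 0 < ρ) {x : E} (hx : ‖x‖ ≤ ρ) :
    radialRetraction ρ x = x := by
  rw [radialRetraction, max_eq_left hx, div_self hρ.ne', one_smul]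

/-- Global solutions of an equation whose right-hand side is truncated to a closed ball. -/
lemma exists_truncated_solution [ProperSpace E] {T : Set ℝ} (hT : IsTimeScale T) {F : ℝ → E → E}
    {a r ρ : ℝ} (ha : a ∈ T) (hρ : 0 < ρ) (hρr : ρ < r)
    (hF : ContinuousOn (fun p : ℝ × E => F p.1 p.2) (ray T a ×ˢ Metric.ball (0 : E) r)) (x₀ : E) :
    ∃ x : ℝ → E, x a = x₀ ∧
      ∀ t ∈ ray T a, HasDeltaDerivAt (ray T a) x (F t (radialRetraction ρ (x t))) t := by
  refine exists_forall_hasDeltaDerivAt (F := fun t y => F t (radialRetraction ρ y)) hT ha ?_ ?_ x₀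
  · refine hF.comp (f := fun p : ℝ × E => (p.1, radialRetraction ρ p.2)) ?_ ?_
    · exact (continuous_fst.prodMk
        ((continuous_radialRetraction hρ).comp continuous_snd)).continuousOn
    · intro p hp
      exact ⟨hp.1, mem_ball_zero_iff.2 ((norm_radialRetraction_le hρ _).trans_lt hρr)⟩
  · intro b
    have hcomp : IsCompact ((T ∩ Icc a b) ×ˢ Metric.closedBall (0 : E) ρ) :=
      (isCompact_Icc.inter_left hT.isClosed).prod (isCompact_closedBall _ _)
    obtain ⟨K, hK⟩ := hcomp.exists_bound_of_continuousOn (hF.mono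
      (prod_mono (fun t ht => ⟨ht.1, ht.2.1⟩) (Metric.closedBall_subset_ball hρr)))
    exact ⟨K, fun t ht h1 h2 y => hK (t, radialRetraction ρ y)
      ⟨⟨ht, h1, h2⟩, mem_closedBall_zero_iff.2 (norm_radialRetraction_le hρ y)⟩⟩

end Stability

end TimeScale

/-! ### The stability and existence theorem -/

open TimeScale in
theorem theorem7p6 {T : Set ℝ} (hT : TimeScale.IsTimeScale T) {n : ℕ}
    (A : Matrix (Fin n) (Fin n) ℝ) (hA : TimeScale.StronglyStable T A) :
    ∃ ε : ℝ, 0 < ε ∧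
      ∀ r : ℝ, 0 < r →
      ∀ f : ℝ → EuclideanSpace ℝ (Fin n) → EuclideanSpace ℝ (Fin n),
        (∃ r₁ : ℝ, 0 < r₁ ∧ r₁ ≤ r ∧
          ∀ t ∈ TimeScale.ray T 0, ∀ x ∈ Metric.ball (0 : EuclideanSpace ℝ (Fin n)) r₁,
            ‖f t x‖ ≤ ε * ‖x‖) →
        TimeScale.ZeroAsymptoticallyStable T r
            (fun t x => Matrix.toEuclideanLin A x + f t x) ∧
          (ContinuousOn (fun p : ℝ × EuclideanSpace ℝ (Fin n) => f p.1 p.2)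
              (TimeScale.ray T 0 ×ˢ Metric.ball (0 : EuclideanSpace ℝ (Fin n)) r) →
            TimeScale.SmallDataGlobalExistence T r
              (fun t x => Matrix.toEuclideanLin A x + f t x)) := by
  obtain ⟨ε, hε, c, hc, hest⟩ := hA.exists_estimate hT
  refine ⟨ε, hε, fun r hr f ⟨r₁, hr₁, hr₁r, hf⟩ => ⟨⟨?_, ?_⟩, fun hcont => ?_⟩⟩
  · intro t₀ ht₀ η hη
    obtain ⟨G, hG, hGest⟩ := hest t₀ ht₀.1
    have hm : 0 < min r₁ η := lt_min hr₁ hη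
    have hGK : G * (min r₁ η / (2 * G)) < min r₁ η := by
      have : G * (min r₁ η / (2 * G)) = min r₁ η / 2 := by field_simp
      rw [this]
      linarith
    refine ⟨min r₁ η / (2 * G), by positivity, fun b _ x hx hx0 t ht => ?_⟩
    have h1 := hGest r₁ _ b x _ (by positivity) (hGK.trans_le (min_le_left _ _)) hx.1
      (fun s hs h1 h2 => ⟨(hx.2 s hs h1 h2).2, fun h3 => by
        rw [add_sub_cancel_left]
        exact hf s ⟨hs, mem_Ici.2 (le_trans ht₀.2 h1)⟩ _ (mem_ball_zero_iff.2 h3)⟩)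
      hx0.le t ht
    refine h1.trans_lt (lt_of_le_of_lt ?_ (hGK.trans_le (min_le_right _ _)))
    refine mul_le_of_le_one_right (by positivity) (Real.exp_le_one_iff.2 ?_)
    nlinarith [ht.2.1]
  · intro t₀ ht₀
    obtain ⟨G, hG, hGest⟩ := hest t₀ ht₀.1
    have hGK : G * (r₁ / (2 * G)) < r₁ := by
      have : G * (r₁ / (2 * G)) = r₁ / 2 := by field_simp
      rw [this]
      linarith
    refine ⟨r₁ / (2 * G), by positivity, fun x hx hx0 => ?_⟩
    have hcx : ∀ b, ContinuousOn x (T ∩ Icc t₀ b) := fun b s hs =>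
      ((hx s ⟨hs.1, hs.2.1⟩).2.continuousWithinAt ⟨hs.1, hs.2.1⟩).mono
        fun u hu => ⟨hu.1, hu.2.1⟩
    have hb : ∀ t ∈ T, t₀ ≤ t → ‖x t‖ ≤ G * (r₁ / (2 * G)) * Real.exp (-c * (t - t₀)) := by
      intro t ht h0t
      exact hGest r₁ _ t x _ (by positivity) hGK (hcx t)
        (fun s hs h1 h2 => ⟨(hx s ⟨hs, h1⟩).2, fun h3 => by
          rw [add_sub_cancel_left]
          exact hf s ⟨hs, mem_Ici.2 (le_trans ht₀.2 h1)⟩ _ (mem_ball_zero_iff.2 h3)⟩)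
        hx0.le t ⟨ht, h0t, le_rfl⟩
    have hlim : Tendsto (fun t => G * (r₁ / (2 * G)) * Real.exp (-c * (t - t₀))) atTop (𝓝 0) := by
      rw [← mul_zero (G * (r₁ / (2 * G)))]
      refine (Real.tendsto_exp_atBot.comp ?_).const_mul _
      exact (tendsto_atTop_add_const_right _ (-t₀) tendsto_id).const_mul_atTop_of_neg (by linarith)
    refine squeeze_zero_norm' ?_ (hlim.mono_left inf_le_left)
    rw [eventually_inf_principal]
    filter_upwards [eventually_ge_atTop t₀] with t h0t ht
    exact hb t ht h0t
  · intro t₀ ht₀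
    obtain ⟨G, hG, hGest⟩ := hest t₀ ht₀.1
    -- The closed ρ-ball lies in the ball where f is small, and the estimate confines solutions to
    -- ‖x‖ < ρ, where the truncation is the identity.
    set ρ := r₁ / 2 with hρ
    have hρ0 : 0 < ρ := by positivity
    have hρr₁ : ρ < r₁ := by rw [hρ]; linarith
    have hGK : G * (ρ / (2 * G)) < ρ := by
      have : G * (ρ / (2 * G)) = ρ / 2 := by field_simp
      rw [this]
      linarith
    refine ⟨ρ / (2 * G), by positivity, fun x₀ hx₀ => ?_⟩
    have hF : ContinuousOn (fun p : ℝ × EuclideanSpace ℝ (Fin n) =>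
        Matrix.toEuclideanLin A p.2 + f p.1 p.2) (ray T t₀ ×ˢ Metric.ball 0 r) := by
      refine ContinuousOn.add ?_ (hcont.mono (prod_mono (fun t ht => ⟨ht.1,
        mem_Ici.2 (le_trans ht₀.2 ht.2)⟩) subset_rfl))
      exact ((Matrix.toEuclideanCLM (𝕜 := ℝ) A).continuous.comp continuous_snd).continuousOn
    obtain ⟨x, hx0, hx⟩ := exists_truncated_solution
      (F := fun t y => Matrix.toEuclideanLin A y + f t y) hT ht₀.1 hρ0 (hρr₁.trans_le hr₁r) hF x₀
    have hcx : ∀ b, ContinuousOn x (T ∩ Icc t₀ b) := fun b s hs =>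
      ((hx s ⟨hs.1, hs.2.1⟩).continuousWithinAt ⟨hs.1, hs.2.1⟩).mono fun u hu => ⟨hu.1, hu.2.1⟩
    have hb : ∀ t ∈ ray T t₀, ‖x t‖ < ρ := by
      intro t ht
      refine (hGest ρ (ρ / (2 * G)) t x _ (by positivity) hGK (hcx t)
        (fun s hs h1 h2 => ⟨hx s ⟨hs, h1⟩, fun h3 => ?_⟩) (by rw [hx0]; exact hx₀.le) t
        ⟨ht.1, ht.2, le_rfl⟩).trans_lt (lt_of_le_of_lt ?_ hGK)
      · rw [radialRetraction_of_norm_le hρ0 h3.le, add_sub_cancel_left]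
        exact hf s ⟨hs, mem_Ici.2 (le_trans ht₀.2 h1)⟩ _
          (mem_ball_zero_iff.2 (h3.trans hρr₁))
      · refine mul_le_of_le_one_right (by positivity) (Real.exp_le_one_iff.2 ?_)
        have : t₀ ≤ t := ht.2
        nlinarith
    refine ⟨x, hx0, fun t ht => ⟨?_, ?_⟩⟩
    · exact mem_ball_zero_iff.2 ((hb t ht).trans (hρr₁.trans_le hr₁r))
    · have := hx t ht
      rwa [radialRetraction_of_norm_le hρ0 (hb t ht).le] at this
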